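/- Let $k$ be an algebraically closed field. By a variety over $k$ we mean a reduced separated scheme of finite type over $k$, not necessarily irreducible; its points are its closed points, i.e. its $k$-points. A vector bundle of rank $n$ on a variety $X$ is a variety $E$ with a morphism $\pi:E\to X$ over $k$ and the structure of an $n$-dimensional $k$-vector space on each fibre $E_x=\pi^{-1}(x)$, $x\in X$, such that $X$ is covered by open sets $U$ for which there is an isomorphism $\pi^{-1}(U)\to U\times k^n$ over $U$ that is linear on the fibres over the points of $U$. Let $X$ be an irreducible variety over $k$, let $E$ be a vector bundle of rank $n$ on $X$, and let $F\subseteq E$ be a closed subvariety satisfying (*) for all $x\in X$ the set $F_x=F\cap E_x$ is a vector subspace of $E_x$, and $\dim F_x$ does not depend on $x$. Then $F$ is irreducible. -/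

import Mathlib

open AlgebraicGeometry CategoryTheory

universe u

namespace SubBundle

noncomputable section

/-- The structure morphism `p : X ⟶ Spec k` makes `X` an algebraic variety over `k` (not
necessarily irreducible): a reduced separated scheme of finite type. -/
structure IsVariety {k : Type u} [Field k] {X : Scheme.{u}} (p : X ⟶ Spec (.of k)) : Prop where
  isReduced : IsReduced X
  isSeparated : IsSeparated p
  locallyOfFiniteType : LocallyOfFiniteType p
  quasiCompact : QuasiCompact p

/-- The `k`-points of `X`. If `k` is algebraically closed and `X` is of finite type, these are the
closed points of `X`, that is, the points of `X` as a classical variety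
(`AlgebraicGeometry.pointEquivClosedPoint`). -/
@[ext] structure KPoint {k : Type u} [Field k] {X : Scheme.{u}} (p : X ⟶ Spec (.of k)) :
    Type u where
  /-- the underlying morphism -/
  hom : Spec (.of k) ⟶ X
  hom_comp : hom ≫ p = 𝟙 _

/-- The point of the underlying space of `X` given by a `k`-point. -/
def KPoint.pt {k : Type u} [Field k] {X : Scheme.{u}} {p : X ⟶ Spec (.of k)} (x : KPoint p) : X :=
  x.hom (IsLocalRing.closedPoint k)

/-- The fibre `E_x` of `π : E ⟶ X` over a `k`-point `x`, as a set of `k`-points of `E`. -/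
@[ext] structure Fibre {k : Type u} [Field k] {X E : Scheme.{u}} {p : X ⟶ Spec (.of k)}
    (π : E ⟶ X) (x : KPoint p) : Type u where
  /-- the underlying morphism -/
  hom : Spec (.of k) ⟶ E
  hom_comp : hom ≫ π = x.hom

lemma Fibre.range_subset {k : Type u} [Field k] {X E : Scheme.{u}} {p : X ⟶ Spec (.of k)}
    {π : E ⟶ X} {x : KPoint p} (e : Fibre π x) {U : X.Opens} (hx : x.pt ∈ U) :
    Set.range e.hom ⊆ Set.range (π ⁻¹ᵁ U).ι := by
  rw [Scheme.Opens.range_ι]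
  rintro _ ⟨a, rfl⟩
  have ha : a = IsLocalRing.closedPoint k := Subsingleton.elim (α := PrimeSpectrum k) _ _
  have key : x.hom a ∈ U := by rw [ha]; exact hx
  rw [← e.hom_comp] at key
  exact key

/-- A point `e` of the fibre `E_x`, regarded as a point of `π⁻¹(U)`, where `x ∈ U`. -/
def Fibre.lift {k : Type u} [Field k] {X E : Scheme.{u}} {p : X ⟶ Spec (.of k)}
    {π : E ⟶ X} {x : KPoint p} (e : Fibre π x) {U : X.Opens} (hx : x.pt ∈ U) :
    Spec (.of k) ⟶ (π ⁻¹ᵁ U).toScheme :=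
  IsOpenImmersion.lift (π ⁻¹ᵁ U).ι e.hom (e.range_subset hx)

/-- The vector in `k^n` of affine coordinates of a point of `𝔸ⁿ_S` with values in `k`. -/
def coords {k : Type u} [Field k] {n : ℕ} {S : Scheme.{u}}
    (a : Spec (.of k) ⟶ AffineSpace (ULift.{u} (Fin n)) S) : Fin n → k :=
  fun i => (Scheme.ΓSpecIso (.of k)).hom (a.appTop (AffineSpace.coord S ⟨i⟩))

/-- A vector bundle of rank `n` on the `k`-variety `X` (with structure morphism `p`): a variety
`E` with a morphism `π : E ⟶ X` and the structure of an `n`-dimensional vector space on each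
fibre, such that `E` is locally isomorphic over `X` to `U × k^n` by isomorphisms which are
linear on the fibres. -/
structure VectorBundle {k : Type u} [Field k] {X : Scheme.{u}} (p : X ⟶ Spec (.of k))
    (n : ℕ) where
  /-- the total space `E` -/
  total : Scheme.{u}
  /-- the projection `π : E ⟶ X` -/
  proj : total ⟶ X
  isVariety : IsVariety (proj ≫ p)
  addCommGroup : ∀ x : KPoint p, AddCommGroup (Fibre proj x)
  module : ∀ x : KPoint p, Module k (Fibre proj x)
  rank_fibre : ∀ x : KPoint p, Module.rank k (Fibre proj x) = n
  locally_trivial : ∀ a : X, ∃ U : X.Opens, a ∈ U ∧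
    ∃ φ : (proj ⁻¹ᵁ U).toScheme ≅ AffineSpace (ULift.{u} (Fin n)) U.toScheme,
      φ.hom ≫ (AffineSpace (ULift.{u} (Fin n)) U.toScheme ↘ U.toScheme) = proj ∣_ U ∧
      ∀ (x : KPoint p) (hx : x.pt ∈ U),
        IsLinearMap k (fun e : Fibre proj x => coords (e.lift hx ≫ φ.hom))

attribute [instance] VectorBundle.addCommGroup VectorBundle.module

/-- The set `F_x = F ∩ E_x` of points of the fibre `E_x` which lie in `F`, for `i : F ⟶ E`. -/
def subFibre {k : Type u} [Field k] {X : Scheme.{u}} {p : X ⟶ Spec (.of k)} {n : ℕ}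
    (E : VectorBundle p n) {F : Scheme.{u}} (i : F ⟶ E.total) (x : KPoint p) :
    Set (Fibre E.proj x) :=
  {e | ∃ f : Spec (.of k) ⟶ F, f ≫ i = e.hom}

/-- Condition (*): `F` is a closed subvariety of `E` (that is, a reduced closed subscheme, with
inclusion `i`), and the `F_x` are vector subspaces of the `E_x` of constant dimension. -/
structure IsSubspaceFamily {k : Type u} [Field k] {X : Scheme.{u}} {p : X ⟶ Spec (.of k)} {n : ℕ}
    (E : VectorBundle p n) {F : Scheme.{u}} (i : F ⟶ E.total) : Prop where
  isClosedImmersion : IsClosedImmersion i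
  isReduced : IsReduced F
  exists_dim : ∃ d : ℕ, ∀ x : KPoint p, ∃ W : Submodule k (Fibre E.proj x),
    (W : Set (Fibre E.proj x)) = subFibre E i x ∧ Module.finrank k W = d

end

end SubBundle

/-! Over an affine chart with coordinate ring the domain `A`, the set `F` is the zero set of a
radical ideal `I` of `A[σ]`, and `I` is homogeneous because the fibres are cones. Near a point of
the base, choose `d` linear forms with constant coefficients which are coordinates on the fibre of
`F` there. In that fibre, `I` and the forms cut out only the origin, so together they contain a
power of the irrelevant ideal. Nakayama's lemma, applied to one graded piece, spreads this to a
neighbourhood (`IsFamilyIdeal.exists_C_mul_mem`).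

Over that neighbourhood the forms define a finite map from `F` to affine `d`-space over the base
(`finite_comp_aeval`). It is injective on each fibre, hence bijective on `k`-points because the
dimension is always `d`. It need not be an isomorphism: over the cusp `(t², t³)` the lines spanned
by `(1, t)` form such a family without being a subbundle. Still, a closed subset of `F` mapping onto
the irreducible target contains every `k`-point of `F`, so `I` is prime (`IsFamilyIdeal.isPrime`).

Finally the local pieces are glued: `X` is irreducible and, by the zero vectors, `F` meets the
preimage of every nonempty open set (`isPreirreducible_of_preimage`). -/

namespace SubspaceFamily

open MvPolynomial

/-! ### The Nullstellensatz for finitely generated algebras -/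

section Nullstellensatz

variable {k B : Type*} [Field k] [IsAlgClosed k] [CommRing B] [Algebra k B]
  [Algebra.FiniteType k B]

lemma exists_algHom_ker_eq (P : Ideal B) [P.IsMaximal] :
    ∃ ψ : B →ₐ[k] k, RingHom.ker ψ = P := by
  let := Ideal.Quotient.field P
  have := finite_of_finite_type_of_isJacobsonRing k (B ⧸ P)
  have hb := IsAlgClosed.algebraMap_bijective_of_isIntegral (k := k) (K := B ⧸ P)
  let e : k ≃ₐ[k] B ⧸ P := AlgEquiv.ofBijective (Algebra.ofId k _) hb
  refine ⟨e.symm.toAlgHom.comp (Ideal.Quotient.mkₐ k P), ?_⟩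
  ext x
  simp [RingHom.mem_ker, Ideal.Quotient.eq_zero_iff_mem]

lemma exists_algHom_of_notMem {I : Ideal B} (hI : I.IsRadical) {f : B} (hf : f ∉ I) :
    ∃ ψ : B →ₐ[k] k, I ≤ RingHom.ker ψ ∧ ψ f ≠ 0 := by
  have := isJacobsonRing_of_finiteType (A := k) (B := B)
  have h := IsJacobsonRing.out this hI
  rw [← h, Ideal.jacobson, Submodule.mem_sInf] at hf
  push Not at hf
  obtain ⟨P, ⟨hIP, hP⟩, hfP⟩ := hf
  obtain ⟨ψ, rfl⟩ := exists_algHom_ker_eq (k := k) P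
  exact ⟨ψ, hIP, hfP⟩

end Nullstellensatz

/-! ### Homogeneous components -/

section Homogeneous

variable {σ A : Type*} [CommRing A]

lemma homogeneousComponent_mul_of_isHomogeneous {a : MvPolynomial σ A} {i : ℕ}
    (ha : a.IsHomogeneous i) (j : ℕ) (b : MvPolynomial σ A) :
    homogeneousComponent (i + j) (a * b) = a * homogeneousComponent j b := by
  classical
  let := gradedAlgebra (σ := σ) (R := A)
  have := DirectSum.coe_decompose_mul_add_of_left_mem (homogeneousSubmodule σ A) (b := b) (j := j)
    ((mem_homogeneousSubmodule i a).2 ha)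
  rw [← decomposition.decompose'_apply, ← decomposition.decompose'_apply]
  exact this

lemma mem_pow_idealOfVars_of_isHomogeneous {f : MvPolynomial σ A} {N : ℕ} (hf : f.IsHomogeneous N) :
    f ∈ idealOfVars σ A ^ N := by
  rw [mem_pow_idealOfVars_iff']
  intro x hx
  exact hf.coeff_eq_zero hx.ne

end Homogeneous

/-! ### Evaluation at `k`-points and constant linear forms -/

variable {k A σ : Type*} [Field k] [CommRing A] [Algebra k A]

/-- Evaluation of a polynomial with coefficients in `A` at the point `(φ, v)` of the affine space
over `Spec A`. -/
noncomputable def evalAt (φ : A →ₐ[k] k) (v : σ → k) : MvPolynomial σ A →ₐ[k] k :=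
  { eval₂Hom (φ : A →+* k) v with
    commutes' := fun r => by
      simp [MvPolynomial.algebraMap_apply] }

@[simp] lemma evalAt_C (φ : A →ₐ[k] k) (v : σ → k) (a : A) : evalAt φ v (C a) = φ a :=
  eval₂_C _ _ _

@[simp] lemma evalAt_X (φ : A →ₐ[k] k) (v : σ → k) (i : σ) : evalAt φ v (X i) = v i :=
  eval₂_X _ _ _

lemma evalAt_apply (φ : A →ₐ[k] k) (v : σ → k) (f : MvPolynomial σ A) :
    evalAt φ v f = eval₂ (φ : A →+* k) v f := rfl

lemma exists_eq_evalAt (ψ : MvPolynomial σ A →ₐ[k] k) :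
    ∃ (φ : A →ₐ[k] k) (v : σ → k), ψ = evalAt φ v := by
  refine ⟨ψ.comp (IsScalarTower.toAlgHom k A (MvPolynomial σ A)), fun i => ψ (X i), ?_⟩
  apply AlgHom.coe_ringHom_injective
  apply MvPolynomial.ringHom_ext
  · intro a
    change _ = evalAt _ _ (C a)
    rw [evalAt_C]; rfl
  · intro i
    change _ = evalAt _ _ (X i)
    rw [evalAt_X]; rfl

lemma evalAt_injective {φ φ' : A →ₐ[k] k} {v v' : σ → k} (h : evalAt φ v = evalAt φ' v') :
    φ = φ' ∧ v = v' := by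
  constructor
  · ext a
    simpa using DFunLike.congr_fun h (C a)
  · ext i
    simpa using DFunLike.congr_fun h (X i)

lemma evalAt_smul_of_isHomogeneous (φ : A →ₐ[k] k) (v : σ → k) (t : k) {f : MvPolynomial σ A}
    {j : ℕ} (hf : f.IsHomogeneous j) : evalAt φ (t • v) f = t ^ j * evalAt φ v f := by
  simp only [evalAt_apply, eval₂_eq, Finset.mul_sum]
  refine Finset.sum_congr rfl fun m hm => ?_
  have hj : ∑ i ∈ m.support, m i = j := by
    have := hf (mem_support_iff.1 hm)
    simpa [Finsupp.weight_apply, Finsupp.sum] using this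
  simp only [Pi.smul_apply, smul_eq_mul, mul_pow, Finset.prod_mul_distrib,
    Finset.prod_pow_eq_pow_sum, hj]
  ring

/-- The linear form with coefficients `c`, as a polynomial over `A`. -/
noncomputable def linearForm [Fintype σ] (A : Type*) [CommRing A] [Algebra k A]
    (c : (σ → k) →ₗ[k] k) : MvPolynomial σ A :=
  open Classical in ∑ i, C (algebraMap k A (c (Pi.single i 1))) * X i

lemma isHomogeneous_linearForm [Fintype σ] (c : (σ → k) →ₗ[k] k) :
    (linearForm A c).IsHomogeneous 1 := by
  refine IsHomogeneous.sum _ _ _ fun i _ => ?_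
  exact isHomogeneous_C_mul_X _ _

@[simp] lemma evalAt_linearForm [Fintype σ] (c : (σ → k) →ₗ[k] k) (φ : A →ₐ[k] k) (v : σ → k) :
    evalAt φ v (linearForm A c) = c v := by
  classical
  conv_rhs => rw [← Finset.univ_sum_single v, map_sum]
  simp only [linearForm, map_sum, map_mul, evalAt_C, evalAt_X, AlgHom.commutes]
  refine Finset.sum_congr rfl fun i _ => ?_
  have : Pi.single i (v i) = v i • (Pi.single i (1 : k) : σ → k) := by
    ext j; simp [Pi.single_apply]
  rw [this, map_smul, smul_eq_mul, mul_comm]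
  congr 2

lemma map_linearForm {B : Type*} [CommRing B] [Algebra k B] [Fintype σ] (ψ : A →ₐ[k] B)
    (c : (σ → k) →ₗ[k] k) :
    MvPolynomial.map (ψ : A →+* B) (linearForm A c) = linearForm B c := by
  simp [linearForm]

end SubspaceFamily

/-! ### Ideals of families of subspaces: homogeneity and finiteness -/

namespace SubspaceFamily

open MvPolynomial

variable {k A σ : Type*} [Field k] [CommRing A] [Algebra k A]

/-- A radical ideal of `A[σ]` whose zero set is a family of `d`-dimensional subspaces of `k^σ`
parametrised by the `k`-points of `Spec A`. -/
structure IsFamilyIdeal (k : Type*) {A σ : Type*} [Field k] [CommRing A] [Algebra k A]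
    (I : Ideal (MvPolynomial σ A)) (d : ℕ) : Prop where
  isRadical : I.IsRadical
  exists_submodule : ∀ φ : A →ₐ[k] k, ∃ W : Submodule k (σ → k),
    (∀ v, v ∈ W ↔ I ≤ RingHom.ker (evalAt φ v)) ∧ Module.finrank k W = d

lemma IsFamilyIdeal.radical_map {B : Type*} [CommRing B] [Algebra k B] {d : ℕ}
    {I : Ideal (MvPolynomial σ A)} (h : IsFamilyIdeal k I d) (ι : A →ₐ[k] B) :
    IsFamilyIdeal k (I.map (MvPolynomial.map (σ := σ) (ι : A →+* B))).radical d where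
  isRadical := Ideal.radical_isRadical _
  exists_submodule φ := by
    obtain ⟨W, hW, hd⟩ := h.exists_submodule (φ.comp ι)
    refine ⟨W, fun v => ?_, hd⟩
    have hp : (RingHom.ker (evalAt φ v)).IsPrime := RingHom.ker_isPrime _
    rw [hW, hp.radical_le_iff, Ideal.map_le_iff_le_comap]
    have : RingHom.ker (evalAt (φ.comp ι) v) =
        (RingHom.ker (evalAt φ v)).comap (MvPolynomial.map (σ := σ) (ι : A →+* B)) := by
      ext f
      simp only [RingHom.mem_ker, Ideal.mem_comap, evalAt_apply, eval₂_map]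
      rfl
    rw [this]

section

variable [IsAlgClosed k] [Algebra.FiniteType k A] [Finite σ]

lemma mem_of_forall_evalAt {I : Ideal (MvPolynomial σ A)} (hI : I.IsRadical)
    {f : MvPolynomial σ A}
    (h : ∀ (φ : A →ₐ[k] k) (v : σ → k), I ≤ RingHom.ker (evalAt φ v) → evalAt φ v f = 0) :
    f ∈ I := by
  by_contra hf
  have : Algebra.FiniteType k (MvPolynomial σ A) :=
    Algebra.FiniteType.trans (S := A) ‹_› inferInstance
  obtain ⟨ψ, hψ, hψf⟩ := exists_algHom_of_notMem (k := k) hI hf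
  obtain ⟨φ, v, rfl⟩ := exists_eq_evalAt ψ
  exact hψf (h φ v hψ)

lemma IsFamilyIdeal.homogeneousComponent_mem {I : Ideal (MvPolynomial σ A)} {d : ℕ}
    (h : IsFamilyIdeal k I d) {f : MvPolynomial σ A} (hf : f ∈ I) (j : ℕ) :
    homogeneousComponent j f ∈ I := by
  refine mem_of_forall_evalAt (k := k) h.isRadical fun φ v hv => ?_
  obtain ⟨W, hW, -⟩ := h.exists_submodule φ
  have hv' := (hW v).2 hv
  -- `P` is the value of `f` at `(φ, t • v)` as a polynomial in `t`. It vanishes for all `t` because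
  -- the fibre is stable under scaling, and `k` is infinite, so every coefficient is zero.
  let P : Polynomial k := ∑ i ∈ Finset.range (f.totalDegree + 1),
    Polynomial.C (evalAt φ v (homogeneousComponent i f)) * Polynomial.X ^ i
  have hP : P = 0 := by
    refine Polynomial.funext fun t => ?_
    have h1 : evalAt φ (t • v) f = 0 := (hW _).1 (W.smul_mem t hv') hf
    rw [← sum_homogeneousComponent f, map_sum] at h1
    rw [Polynomial.eval_zero, ← h1, Polynomial.eval_finsetSum]
    refine Finset.sum_congr rfl fun i _ => ?_
    rw [evalAt_smul_of_isHomogeneous φ v t (homogeneousComponent_isHomogeneous i f)]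
    rw [Polynomial.eval_mul, Polynomial.eval_C, Polynomial.eval_pow, Polynomial.eval_X, mul_comm]
  by_cases hj : j < f.totalDegree + 1
  · have := congr_arg (fun p => Polynomial.coeff p j) hP
    simp only [P, Polynomial.finsetSum_coeff, Polynomial.coeff_C_mul, Polynomial.coeff_X_pow,
      mul_ite, mul_one, mul_zero, Finset.sum_ite_eq, Finset.mem_range, hj, if_true,
      Polynomial.coeff_zero] at this
    exact this
  · rw [homogeneousComponent_eq_zero _ _ (by omega), map_zero]

end

lemma homogeneousComponent_succ_of_mem_sup_span {ι : Type*} [Fintype ι]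
    {I : Ideal (MvPolynomial σ A)} (hI : ∀ f ∈ I, ∀ j, homogeneousComponent j f ∈ I)
    {l : ι → MvPolynomial σ A} (hl : ∀ i, (l i).IsHomogeneous 1) {f : MvPolynomial σ A}
    (hf : f ∈ I ⊔ Ideal.span (Set.range l)) (n : ℕ) :
    ∃ a ∈ I, ∃ b : ι → MvPolynomial σ A, (∀ i, (b i).IsHomogeneous n) ∧
      homogeneousComponent (n + 1) f = a + ∑ i, b i * l i := by
  obtain ⟨a, ha, c, hc, rfl⟩ := Submodule.mem_sup.1 hf
  obtain ⟨b, rfl⟩ := (Ideal.mem_span_range_iff_exists_fun).1 hc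
  refine ⟨_, hI a ha (n + 1), fun i => homogeneousComponent n (b i),
    fun i => homogeneousComponent_isHomogeneous _ _, ?_⟩
  rw [map_add, map_sum]
  congr 1
  refine Finset.sum_congr rfl fun i _ => ?_
  rw [mul_comm, add_comm, homogeneousComponent_mul_of_isHomogeneous (hl i), mul_comm]

/-- Graded Nakayama: modulo `I`, a form of degree greater than `N` is a combination of the `l i`
with coefficients of smaller degree, so the monomials of degree at most `N` generate. A general
quotient `Q` is allowed because primality needs the case of `I ⊔ (f)`, which need not be
homogeneous. -/
lemma finite_comp_aeval {ι Q : Type*} [Fintype ι] [Finite σ] [CommRing Q]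
    {I : Ideal (MvPolynomial σ A)} (hI : ∀ f ∈ I, ∀ j, homogeneousComponent j f ∈ I)
    {l : ι → MvPolynomial σ A} (hl : ∀ i, (l i).IsHomogeneous 1) {N : ℕ}
    (hN : idealOfVars σ A ^ (N + 1) ≤ I ⊔ Ideal.span (Set.range l))
    {π : MvPolynomial σ A →+* Q} (hπ : Function.Surjective π) (hπI : I ≤ RingHom.ker π) :
    (π.comp (aeval (R := A) l).toRingHom).Finite := by
  algebraize [π.comp (aeval (R := A) l).toRingHom]
  let S : Set Q :=
    (fun m : σ →₀ ℕ => π (monomial m 1)) '' {m | m.degree ≤ N}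
  have hS : S.Finite := (Finsupp.finite_of_degree_le N).image _
  have hC (a : A) (f) : π (C a * f) =
      (C a : MvPolynomial ι A) • π f := by
    rw [Algebra.smul_def, map_mul]
    congr 1
    simp [RingHom.algebraMap_toAlgebra]
  have hX (i) (f) : π (f * l i) =
      (X i : MvPolynomial ι A) • π f := by
    rw [Algebra.smul_def, map_mul, mul_comm]
    congr 1
    simp [RingHom.algebraMap_toAlgebra]
  have key : ∀ D (f : MvPolynomial σ A), f.IsHomogeneous D →
      π f ∈ Submodule.span (MvPolynomial ι A) S := by
    have low (D) (f : MvPolynomial σ A) (hf : f.IsHomogeneous D) (hD : D ≤ N) :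
        π f ∈ Submodule.span (MvPolynomial ι A) S := by
      rw [f.as_sum, map_sum]
      refine Submodule.sum_mem _ fun m hm => ?_
      rw [← mul_one (coeff m f), ← C_mul_monomial, hC]
      refine Submodule.smul_mem _ _ (Submodule.subset_span ⟨m, ?_, rfl⟩)
      have := not_imp_comm.1 hf.coeff_eq_zero (mem_support_iff.1 hm)
      exact this.trans_le hD
    intro D
    induction D with
    | zero => exact fun f hf => low 0 f hf (Nat.zero_le _)
    | succ D ih =>
      intro f hf
      by_cases hD : D + 1 ≤ N
      · exact low _ f hf hD
      · have hfJ : f ∈ I ⊔ Ideal.span (Set.range l) :=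
            hN (Ideal.pow_le_pow_right (by omega) (mem_pow_idealOfVars_of_isHomogeneous hf))
        obtain ⟨a, ha, b, hb, hab⟩ := homogeneousComponent_succ_of_mem_sup_span hI hl hfJ D
        rw [homogeneousComponent_of_mem hf, if_pos rfl] at hab
        rw [hab, map_add, show π a = 0 from hπI ha, zero_add, map_sum]
        refine Submodule.sum_mem _ fun i _ => ?_
        rw [hX]
        exact Submodule.smul_mem _ _ (ih _ (hb i))
  refine ⟨⟨hS.toFinset, ?_⟩⟩
  rw [hS.coe_toFinset, eq_top_iff]
  rintro x -
  obtain ⟨f, rfl⟩ := hπ x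
  rw [← sum_homogeneousComponent f, map_sum]
  exact Submodule.sum_mem _ fun i _ => key i _ (homogeneousComponent_isHomogeneous i f)

end SubspaceFamily

/-! ### Primality when the linear forms give a finite map -/

namespace SubspaceFamily

open MvPolynomial

variable {k A σ : Type*} [Field k] [CommRing A] [Algebra k A] [Fintype σ]

lemma algHom_eq_of_ker_le {B : Type*} [CommRing B] [Algebra k B] {ψ ψ' : B →ₐ[k] k}
    (h : RingHom.ker ψ ≤ RingHom.ker ψ') : ψ = ψ' := by
  ext b
  have : b - algebraMap k B (ψ b) ∈ RingHom.ker ψ := by simp [RingHom.mem_ker]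
  exact (by simpa [RingHom.mem_ker, sub_eq_zero] using h this : ψ' b = ψ b).symm

/-- Two points in the same fibre of a family of `d`-dimensional subspaces with the same image under
`d` linear forms agree, and all values of the forms occur, as soon as the family together with the
forms generates a power of the irrelevant ideal. -/
lemma IsFamilyIdeal.existsUnique_evalAt {I : Ideal (MvPolynomial σ A)} {d : ℕ}
    (h : IsFamilyIdeal k I d) {L : (σ → k) →ₗ[k] (Fin d → k)} {N : ℕ}
    (hN : idealOfVars σ A ^ (N + 1) ≤
      I ⊔ Ideal.span (Set.range fun j => linearForm A (LinearMap.proj j ∘ₗ L)))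
    (φ : A →ₐ[k] k) (w : Fin d → k) :
    ∃! v : σ → k, I ≤ RingHom.ker (evalAt φ v) ∧ L v = w := by
  obtain ⟨W, hW, hd⟩ := h.exists_submodule φ
  have hinj : Function.Injective (L ∘ₗ W.subtype) := by
    rw [← LinearMap.ker_eq_bot, LinearMap.ker_eq_bot']
    rintro ⟨v, hv⟩ hLv
    replace hLv : L v = 0 := hLv
    have hle : I ⊔ Ideal.span (Set.range fun j => linearForm A (LinearMap.proj j ∘ₗ L)) ≤
        RingHom.ker (evalAt φ v) := by
      refine sup_le ((hW v).1 hv) (Ideal.span_le.2 ?_)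
      rintro _ ⟨j, rfl⟩
      simp [RingHom.mem_ker, hLv]
    ext i
    -- The power `X i ^ (N + 1)` vanishes at `(φ, v)`, hence so does the coordinate `v i`.
    have := hle (hN (Ideal.pow_mem_pow (Ideal.subset_span (Set.mem_range_self i)) _))
    simpa [RingHom.mem_ker] using this
  have hbij : Function.Bijective (L ∘ₗ W.subtype) :=
    ⟨hinj, (LinearMap.injective_iff_surjective_of_finrank_eq_finrank (by simp [hd])).1 hinj⟩
  obtain ⟨⟨v, hv⟩, hvw⟩ := hbij.2 w
  refine ⟨v, ⟨(hW v).1 hv, hvw⟩, fun v' ⟨hv', hvw'⟩ => ?_⟩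
  exact congr_arg Subtype.val (@hinj ⟨v', (hW v').2 hv'⟩ ⟨v, hv⟩ (hvw'.trans hvw.symm))

variable [IsAlgClosed k] [Algebra.FiniteType k A]

/-- If `f` is not in `I`, its zero set in the family does not surject onto affine `d`-space, so some
nonzero polynomial in the forms lies in `I ⊔ (f)`. For `f₁ * f₂ ∈ I` the product of two such
polynomials lies in `I`, which contains no nonzero polynomial in the forms. -/
theorem IsFamilyIdeal.isPrime [IsDomain A] {I : Ideal (MvPolynomial σ A)} {d : ℕ}
    (h : IsFamilyIdeal k I d) {L : (σ → k) →ₗ[k] (Fin d → k)} {N : ℕ}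
    (hN : idealOfVars σ A ^ (N + 1) ≤
      I ⊔ Ideal.span (Set.range fun j => linearForm A (LinearMap.proj j ∘ₗ L))) :
    I.IsPrime := by
  set l := fun j => linearForm A (LinearMap.proj j ∘ₗ L) with hl
  have hlv (φ : A →ₐ[k] k) (v : σ → k) :
      (evalAt φ v).comp ((aeval (R := A) l).restrictScalars k) = evalAt φ (L v) := by
    obtain ⟨φ', v', h'⟩ := exists_eq_evalAt
      ((evalAt φ v).comp ((aeval (R := A) l).restrictScalars k))
    rw [h']
    congr 1
    · ext a
      simpa using (DFunLike.congr_fun h' (C a)).symm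
    · ext i
      simpa [hl] using (DFunLike.congr_fun h' (X i)).symm
  have hbij := h.existsUnique_evalAt hN
  have hft : Algebra.FiniteType k (MvPolynomial (Fin d) A) :=
    Algebra.FiniteType.trans (S := A) ‹_› inferInstance
  -- the ideal `I` does not meet the polynomials in the linear forms
  have hdom (g : MvPolynomial (Fin d) A) (hg : aeval l g ∈ I) : g = 0 := by
    by_contra hg0
    obtain ⟨ψ, -, hψ⟩ := exists_algHom_of_notMem (k := k)
      (I := (⊥ : Ideal (MvPolynomial (Fin d) A)))
      (Ideal.isRadical_iff_quotient_reduced _ |>.2 inferInstance) (f := g) hg0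
    obtain ⟨φ, w, rfl⟩ := exists_eq_evalAt ψ
    obtain ⟨v, ⟨hv, rfl⟩, -⟩ := hbij φ w
    rw [← hlv] at hψ
    exact hψ (hv hg)
  have hfin (f : MvPolynomial σ A) :
      ((Ideal.Quotient.mk (I ⊔ Ideal.span {f})).comp (aeval (R := A) l).toRingHom).Finite :=
    finite_comp_aeval (fun f hf j => h.homogeneousComponent_mem hf j)
      (fun j => isHomogeneous_linearForm _) hN Ideal.Quotient.mk_surjective
      (by rw [Ideal.mk_ker]; exact le_sup_left)
  -- Lying over gives a `k`-point of the zero set of `I ⊔ (f)` above each `(φ, L v)`. By uniqueness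
  -- in `hbij` it is `(φ, v)` itself, so `f` vanishes on the whole family.
  have hlift (f : MvPolynomial σ A) (hf : Function.Injective
      ((Ideal.Quotient.mk (I ⊔ Ideal.span {f})).comp (aeval (R := A) l).toRingHom)) : f ∈ I := by
    refine mem_of_forall_evalAt (k := k) h.isRadical fun φ v hv => ?_
    let θ := (Ideal.Quotient.mk (I ⊔ Ideal.span {f})).comp (aeval (R := A) l).toRingHom
    have hint : θ.IsIntegral := (hfin f).to_isIntegral
    let := θ.toAlgebra
    have : Algebra.IsIntegral (MvPolynomial (Fin d) A) (MvPolynomial σ A ⧸ I ⊔ Ideal.span {f}) :=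
      ⟨hint⟩
    have hmax : (RingHom.ker (evalAt φ (L v))).IsMaximal :=
      RingHom.ker_isMaximal_of_surjective _ fun c => ⟨algebraMap k _ c, by simp⟩
    obtain ⟨Q, hQ, hQc⟩ := Ideal.exists_ideal_over_maximal_of_isIntegral
      (S := MvPolynomial σ A ⧸ I ⊔ Ideal.span {f}) (RingHom.ker (evalAt φ (L v)))
      (by
        have : RingHom.ker θ = ⊥ := (RingHom.injective_iff_ker_eq_bot _).1 hf
        exact this.le.trans bot_le)
    have hQ' : (Q.comap (Ideal.Quotient.mk (I ⊔ Ideal.span {f}))).IsMaximal :=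
      Ideal.comap_isMaximal_of_surjective _ Ideal.Quotient.mk_surjective
    obtain ⟨ψ, hψ⟩ := exists_algHom_ker_eq (k := k)
      (Q.comap (Ideal.Quotient.mk (I ⊔ Ideal.span {f})))
    obtain ⟨φ', v', rfl⟩ := exists_eq_evalAt ψ
    have hle : I ⊔ Ideal.span {f} ≤ RingHom.ker (evalAt φ' v') := by
      rw [hψ]
      intro x hx
      rw [Ideal.mem_comap, Ideal.Quotient.eq_zero_iff_mem.2 hx]
      exact Q.zero_mem
    have hker : RingHom.ker (evalAt φ (L v)) ≤ RingHom.ker (evalAt φ' (L v')) := by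
      intro x hx
      rw [← hQc] at hx
      have hx' : aeval l x ∈ Q.comap (Ideal.Quotient.mk (I ⊔ Ideal.span {f})) := hx
      rw [← hψ] at hx'
      rw [← hlv]
      exact hx'
    obtain ⟨rfl, hL⟩ := evalAt_injective (algHom_eq_of_ker_le hker)
    obtain rfl := (hbij φ (L v)).unique ⟨hv, rfl⟩ ⟨le_sup_left.trans hle, hL.symm⟩
    exact hle (Ideal.mem_sup_right (Ideal.mem_span_singleton_self f))
  refine ⟨?_, ?_⟩
  -- `I` is proper: the domain `A` has a `k`-point, and the fibre above it is nonempty.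
  · rintro rfl
    obtain ⟨φ, -⟩ := exists_algHom_of_notMem (k := k) (I := (⊥ : Ideal A)) (f := 1)
      (Ideal.isRadical_iff_quotient_reduced _ |>.2 inferInstance) (by simp)
    obtain ⟨v, ⟨hv, -⟩, -⟩ := hbij φ 0
    simpa [RingHom.mem_ker] using hv (Submodule.mem_top (x := 1))
  · intro f₁ f₂ hf
    by_contra! hcon
    have h₁ := mt (hlift f₁) hcon.1
    have h₂ := mt (hlift f₂) hcon.2
    rw [injective_iff_map_eq_zero] at h₁ h₂
    push Not at h₁ h₂
    obtain ⟨g₁, hg₁, hg₁'⟩ := h₁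
    obtain ⟨g₂, hg₂, hg₂'⟩ := h₂
    have : g₁ * g₂ = 0 := by
      refine hdom _ ?_
      rw [map_mul]
      have m₁ := Ideal.Quotient.eq_zero_iff_mem.1 hg₁
      have m₂ := Ideal.Quotient.eq_zero_iff_mem.1 hg₂
      have := Ideal.mul_mem_mul m₁ m₂
      refine (?_ : (I ⊔ Ideal.span {f₁}) * (I ⊔ Ideal.span {f₂}) ≤ I) this
      rw [Ideal.sup_mul, Ideal.mul_sup, Ideal.mul_sup, Ideal.span_singleton_mul_span_singleton]
      simp only [sup_le_iff]
      exact ⟨⟨Ideal.mul_le_left, Ideal.mul_le_left⟩, Ideal.mul_le_right,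
        (Ideal.span_singleton_le_iff_mem _).2 hf⟩
    exact (mul_ne_zero hg₁' hg₂') this

end SubspaceFamily

/-! ### Choice of linear forms and irreducibility near a point -/

namespace SubspaceFamily

open MvPolynomial

variable {k A σ : Type*} [Field k] [IsAlgClosed k] [CommRing A] [Algebra k A] [Fintype σ]

lemma IsFamilyIdeal.exists_pow_idealOfVars_le_map {I : Ideal (MvPolynomial σ A)} {d : ℕ}
    (h : IsFamilyIdeal k I d) (φ : A →ₐ[k] k) :
    ∃ (L : (σ → k) →ₗ[k] (Fin d → k)) (N : ℕ), idealOfVars σ k ^ N ≤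
      (I ⊔ Ideal.span (Set.range fun j => linearForm A (LinearMap.proj j ∘ₗ L))).map
        (MvPolynomial.map (φ : A →+* k)) := by
  obtain ⟨W, hW, hd⟩ := h.exists_submodule φ
  -- `L` extends an isomorphism from the fibre `W` to `k^d`, so `W` meets its kernel only in `0`.
  -- The Nullstellensatz then bounds the power.
  obtain ⟨L, hL⟩ := LinearMap.exists_extend
    (LinearEquiv.ofFinrankEq W (Fin d → k) (by simpa using hd)).toLinearMap
  have hL0 (v) (hv : v ∈ W) (h0 : L v = 0) : v = 0 := by
    have := DFunLike.congr_fun hL ⟨v, hv⟩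
    simp only [LinearMap.comp_apply, Submodule.subtype_apply, h0] at this
    simpa using this.symm
  set J := I ⊔ Ideal.span (Set.range fun j => linearForm A (LinearMap.proj j ∘ₗ L)) with hJ
  refine ⟨L, Ideal.exists_pow_le_of_le_radical_of_fg (Ideal.span_le.2 ?_) (idealOfVars_fg σ k)⟩
  rintro _ ⟨i, rfl⟩
  rw [SetLike.mem_coe, ← vanishingIdeal_zeroLocus_eq_radical (K := k), mem_vanishingIdeal_iff]
  intro v hv
  have hJv : J ≤ RingHom.ker (evalAt φ v) := by
    intro f hf
    have := (mem_zeroLocus_iff.1 hv) _ (Ideal.mem_map_of_mem _ hf)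
    rwa [aeval_def, eval₂_map, Algebra.algebraMap_self, RingHom.id_comp] at this
  have h0 : v = 0 := by
    refine hL0 v ((hW v).2 (le_sup_left.trans hJv)) ?_
    ext j
    have := hJv (Ideal.mem_sup_right (Ideal.subset_span ⟨j, rfl⟩))
    simpa [RingHom.mem_ker] using this
  simp [h0]

variable [Algebra.FiniteType k A]

/-- Nakayama's lemma at `φ` for the image of the forms of degree `N + 1` in `A[σ] / J`. A single
degree is used because that graded piece is a finite `A`-module. -/
lemma IsFamilyIdeal.exists_C_mul_mem {I : Ideal (MvPolynomial σ A)} {d : ℕ}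
    (h : IsFamilyIdeal k I d) (φ : A →ₐ[k] k) :
    ∃ (L : (σ → k) →ₗ[k] (Fin d → k)) (N : ℕ) (g : A), φ g ≠ 0 ∧
      ∀ f : MvPolynomial σ A, f.IsHomogeneous (N + 1) → C g * f ∈
        I ⊔ Ideal.span (Set.range fun j => linearForm A (LinearMap.proj j ∘ₗ L)) := by
  obtain ⟨L, N, hN⟩ := h.exists_pow_idealOfVars_le_map φ
  set J := I ⊔ Ideal.span (Set.range fun j => linearForm A (LinearMap.proj j ∘ₗ L)) with hJ
  let q : MvPolynomial σ A →ₗ[A] MvPolynomial σ A ⧸ J := (Ideal.Quotient.mkₐ A J).toLinearMap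
  have hsurj : Function.Surjective (MvPolynomial.map (σ := σ) (φ : A →+* k)) :=
    map_surjective _ fun c => ⟨algebraMap k A c, by simp⟩
  have hfg : ((homogeneousSubmodule σ A (N + 1)).map q).FG :=
    (homogeneousSubmodule_fg σ A (N + 1)).map q
  obtain ⟨g, hg, hg'⟩ := Submodule.exists_sub_one_mem_and_smul_eq_zero_of_fg_of_le_smul
    (RingHom.ker φ) _ hfg (by
      rintro _ ⟨f, hf, rfl⟩
      have h1 : MvPolynomial.map (φ : A →+* k) f ∈ J.map (MvPolynomial.map (φ : A →+* k)) :=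
        hN (Ideal.pow_le_pow_right (Nat.le_succ N)
          (mem_pow_idealOfVars_of_isHomogeneous (IsHomogeneous.map hf _)))
      obtain ⟨j, hj, hjf⟩ := (Ideal.mem_map_iff_of_surjective _ hsurj).1 h1
      have h2 : f - j ∈ (RingHom.ker φ).map (algebraMap A (MvPolynomial σ A)) := by
        have : f - j ∈ RingHom.ker (MvPolynomial.map (σ := σ) (φ : A →+* k)) := by
          rw [RingHom.mem_ker, map_sub, hjf, sub_self]
        rwa [ker_map] at this
      -- The element `j` that agrees with `f` modulo `ker φ` need not be homogeneous. Its component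
      -- of degree `N + 1` replaces it, and stays in `J` by `h4`.
      have h3 : homogeneousComponent (N + 1) (f - j) ∈
          RingHom.ker φ • homogeneousSubmodule σ A (N + 1) := by
        have : f - j ∈ RingHom.ker φ • (⊤ : Submodule A (MvPolynomial σ A)) := by
          rw [Ideal.smul_top_eq_map]; exact h2
        have := Submodule.mem_map_of_mem (f := homogeneousComponent (N + 1)) this
        rw [Submodule.map_smul''] at this
        refine Submodule.smul_mono le_rfl ?_ this
        rintro _ ⟨x, -, rfl⟩
        exact (mem_homogeneousSubmodule _ _).2 (homogeneousComponent_isHomogeneous _ _)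
      have h4 : homogeneousComponent (N + 1) j ∈ J := by
        obtain ⟨a, ha, b, -, hab⟩ := homogeneousComponent_succ_of_mem_sup_span
          (fun f hf j => h.homogeneousComponent_mem hf j)
          (fun j => isHomogeneous_linearForm _) hj N
        rw [hab]
        exact add_mem (Ideal.mem_sup_left ha) (sum_mem fun i _ => Ideal.mem_sup_right
          (Ideal.mul_mem_left _ _ (Ideal.subset_span ⟨i, rfl⟩)))
      rw [← Submodule.map_smul'']
      refine ⟨_, h3, ?_⟩
      rw [map_sub, map_sub, homogeneousComponent_of_mem hf, if_pos rfl, sub_eq_self]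
      exact Ideal.Quotient.eq_zero_iff_mem.2 h4)
  refine ⟨L, N, g, ?_, fun f hf => ?_⟩
  · have : φ g - 1 = 0 := by simpa [RingHom.mem_ker] using hg
    rw [sub_eq_zero.1 this]
    exact one_ne_zero
  · have := hg' _ ⟨f, hf, rfl⟩
    rw [← map_smul, smul_eq_C_mul] at this
    exact Ideal.Quotient.eq_zero_iff_mem.1 this

theorem IsFamilyIdeal.exists_isPreirreducible [IsDomain A] {I : Ideal (MvPolynomial σ A)} {d : ℕ}
    (h : IsFamilyIdeal k I d) (φ : A →ₐ[k] k) :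
    ∃ g : A, φ g ≠ 0 ∧ IsPreirreducible
      (PrimeSpectrum.zeroLocus (I : Set (MvPolynomial σ A)) ∩
        PrimeSpectrum.basicOpen (C (σ := σ) g)) := by
  obtain ⟨L, N, g, hg, hgN⟩ := h.exists_C_mul_mem φ
  refine ⟨g, hg, ?_⟩
  have hg0 : g ≠ 0 := fun h => hg (by simp [h])
  -- Over `B` the element `g` is a unit and can be cancelled from `hgN`, which gives the hypothesis
  -- of `IsFamilyIdeal.isPrime`.
  let B := Localization.Away g
  have : IsDomain B := IsLocalization.isDomain_localization
    (powers_le_nonZeroDivisors_of_noZeroDivisors hg0)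
  have : Algebra.FiniteType A B := IsLocalization.finiteType_of_monoid_fg (Submonoid.powers g) B
  have : Algebra.FiniteType k B := Algebra.FiniteType.trans (S := A) ‹_› ‹_›
  let ι : A →ₐ[k] B := IsScalarTower.toAlgHom k A B
  have h' := h.radical_map ι
  have hprime := h'.isPrime (L := L) (N := N) (by
    rw [pow_idealOfVars_eq_span, Ideal.span_le]
    rintro _ ⟨m, hm, rfl⟩
    have h1 := hgN (monomial m 1) (isHomogeneous_monomial 1 hm)
    have h2 := Ideal.mem_map_of_mem (MvPolynomial.map (σ := σ) (ι : A →+* B)) h1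
    rw [Ideal.map_sup, Ideal.map_span, ← Set.range_comp] at h2
    simp only [Function.comp_def, map_linearForm, map_mul, map_C, map_monomial, map_one] at h2
    have hu : IsUnit (C (ι g) : MvPolynomial σ B) :=
      (IsLocalization.Away.algebraMap_isUnit (S := B) g).map C
    replace h2 := (Ideal.unit_mul_mem_iff_mem _ hu).1 h2
    refine (?_ : _ ≤ (_ : Ideal (MvPolynomial σ B))) h2
    exact sup_le_sup Ideal.le_radical le_rfl)
  let := algebraMvPolynomial (σ := σ) (R := A) (S := B)
  have := MvPolynomial.isLocalization (σ := σ) (Submonoid.powers g) B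
  rw [Submonoid.map_powers] at this
  have : IsLocalization.Away (C g : MvPolynomial σ A) (MvPolynomial σ B) := this
  rw [← PrimeSpectrum.localization_away_comap_range (MvPolynomial σ B) (C g : MvPolynomial σ A),
    ← Set.image_preimage_eq_inter_range, PrimeSpectrum.preimage_comap_zeroLocus]
  refine IsPreirreducible.image ?_ _ (PrimeSpectrum.continuous_comap _).continuousOn
  rw [← PrimeSpectrum.zeroLocus_span, ← PrimeSpectrum.zeroLocus_radical]
  exact ((PrimeSpectrum.isIrreducible_zeroLocus_iff_of_radical _
    (Ideal.radical_isRadical _)).2 hprime).isPreirreducible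

end SubspaceFamily

/-! ### Gluing irreducible pieces over an irreducible base -/

namespace SubspaceFamily

open MvPolynomial

/-- Given `u` and `v` meeting `Z`, irreducibility over `U₁` moves a point of `Z ∩ u` to one over `U₁
∩ U₂`, and irreducibility over `U₂` then makes it meet `v`. A suitable point is required only in
each nonempty open part of `Z`, so that closed points suffice. -/
lemma isPreirreducible_of_preimage {E X : Type*} [TopologicalSpace E] [TopologicalSpace X]
    [PreirreducibleSpace X] {π : E → X} (hπ : Continuous π) {Z : Set E}
    (hloc : ∀ V : Set E, IsOpen V → (Z ∩ V).Nonempty →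
      ∃ e ∈ Z ∩ V, ∃ U : Set X, IsOpen U ∧ π e ∈ U ∧ IsPreirreducible (Z ∩ π ⁻¹' U))
    (hne : ∀ U : Set X, IsOpen U → U.Nonempty → (Z ∩ π ⁻¹' U).Nonempty) :
    IsPreirreducible Z := by
  intro u v hu hv hZu hZv
  obtain ⟨e₁, ⟨h₁Z, h₁u⟩, U₁, hU₁, h₁, hirr₁⟩ := hloc u hu hZu
  obtain ⟨e₂, ⟨h₂Z, h₂v⟩, U₂, hU₂, h₂, hirr₂⟩ := hloc v hv hZv
  obtain ⟨e, heZ, he⟩ := hne (U₁ ∩ U₂) (hU₁.inter hU₂)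
    (nonempty_preirreducible_inter hU₁ hU₂ ⟨_, h₁⟩ ⟨_, h₂⟩)
  obtain ⟨e', ⟨h'Z, -⟩, h'u, h'⟩ := hirr₁ u (π ⁻¹' U₂) hu (hU₂.preimage hπ)
    ⟨e₁, ⟨h₁Z, h₁⟩, h₁u⟩ ⟨e, ⟨heZ, he.1⟩, he.2⟩
  obtain ⟨e'', ⟨h''Z, -⟩, h''⟩ := hirr₂ u v hu hv ⟨e', ⟨h'Z, h'⟩, h'u⟩ ⟨e₂, ⟨h₂Z, h₂⟩, h₂v⟩
  exact ⟨e'', h''Z, h''⟩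

/-! ### Affine charts of a vector bundle -/

open SubBundle

variable {k : Type u} [Field k]

lemma coords_comp_map {n : ℕ} {R : CommRingCat.{u}} {S : Scheme.{u}} (g : Spec R ⟶ S)
    (ψ : R →+* k) (v : ULift.{u} (Fin n) → k) :
    coords (Spec.map (CommRingCat.ofHom (eval₂Hom ψ v)) ≫
      (AffineSpace.SpecIso _ R).inv ≫ AffineSpace.map _ g) = fun i => v ⟨i⟩ := by
  funext i
  have h1 : (AffineSpace.map (ULift.{u} (Fin n)) g).appTop (AffineSpace.coord S ⟨i⟩) =
    AffineSpace.coord (Spec R) ⟨i⟩ := AffineSpace.map_appTop_coord _ _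
  have h2 := AffineSpace.SpecIso_inv_appTop_coord (n := ULift.{u} (Fin n)) R ⟨i⟩
  simp only [coords, Scheme.Hom.comp_appTop, CommRingCat.comp_apply]
  rw [h1, h2, ← CommRingCat.comp_apply, Scheme.ΓSpecIso_naturality, CommRingCat.comp_apply]
  simp

lemma eq_of_coords_eq {n : ℕ} {S : Scheme.{u}}
    {a b : Spec (.of k) ⟶ AffineSpace (ULift.{u} (Fin n)) S}
    (h : a ≫ (AffineSpace (ULift.{u} (Fin n)) S ↘ S) = b ≫ (AffineSpace (ULift.{u} (Fin n)) S ↘ S))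
    (hc : coords a = coords b) : a = b := by
  refine AffineSpace.hom_ext h fun i => ?_
  exact (Scheme.ΓSpecIso (.of k)).commRingCatIsoToRingEquiv.injective (congr_fun hc i.down)

/-- A vector bundle is trivial on affine charts, compatibly with the vector space structure on the
fibres. -/
lemma exists_chart {X : Scheme.{u}} {p : X ⟶ Spec (.of k)} {n : ℕ} (E : VectorBundle p n) (a : X) :
    ∃ (R : CommRingCat.{u}) (f : Spec R ⟶ X)
      (J : Spec (.of (MvPolynomial (ULift.{u} (Fin n)) R)) ⟶ E.total),
      IsOpenImmersion f ∧ a ∈ Set.range f ∧ IsOpenImmersion J ∧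
      J ≫ E.proj = Spec.map (CommRingCat.ofHom C) ≫ f ∧
      Set.range J = E.proj ⁻¹' Set.range f ∧
      ∀ (x : KPoint p) (ψ : R →+* k), Spec.map (CommRingCat.ofHom ψ) ≫ f = x.hom →
        ∃ c : Fibre E.proj x ≃ₗ[k] (ULift.{u} (Fin n) → k),
          ∀ e, Spec.map (CommRingCat.ofHom (eval₂Hom ψ (c e))) ≫ J = e.hom := by
  obtain ⟨U, haU, φ, hφ, hlin⟩ := E.locally_trivial a
  obtain ⟨R, f, hf, haf, hfU⟩ := Scheme.exists_affine_mem_range_and_range_subset haU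
  have hfU' : Set.range f ⊆ Set.range U.ι := by rwa [Scheme.Opens.range_ι]
  let g : Spec R ⟶ U.toScheme := IsOpenImmersion.lift U.ι f hfU'
  have hg : g ≫ U.ι = f := IsOpenImmersion.lift_fac _ _ _
  have hgo : IsOpenImmersion g := by
    have : IsOpenImmersion (g ≫ U.ι) := by rwa [hg]
    exact IsOpenImmersion.of_comp g U.ι
  have hpb := AffineSpace.isPullback_map (n := ULift.{u} (Fin n)) g
  have hmo : IsOpenImmersion (AffineSpace.map (ULift.{u} (Fin n)) g) :=
    MorphismProperty.of_isPullback hpb.flip hgo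
  let ι := (E.proj ⁻¹ᵁ U).ι
  have hφi : φ.inv ≫ ι ≫ E.proj =
      (AffineSpace (ULift.{u} (Fin n)) U.toScheme ↘ U.toScheme) ≫ U.ι := by
    rw [Iso.inv_comp_eq, reassoc_of% hφ, morphismRestrict_ι]
  let q : Spec (.of (MvPolynomial (ULift.{u} (Fin n)) R)) ⟶
      AffineSpace (ULift.{u} (Fin n)) U.toScheme :=
    (AffineSpace.SpecIso _ R).inv ≫ AffineSpace.map _ g
  have hq : q ≫ (AffineSpace (ULift.{u} (Fin n)) U.toScheme ↘ U.toScheme) =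
      Spec.map (CommRingCat.ofHom C) ≫ g := by
    simp [q]
  refine ⟨R, f, q ≫ φ.inv ≫ ι, hf, haf, inferInstance, ?_, ?_, ?_⟩
  · simp only [Category.assoc]
    rw [hφi, reassoc_of% hq, hg]
  · refine Set.Subset.antisymm ?_ ?_
    · rintro _ ⟨r, rfl⟩
      refine ⟨Spec.map (CommRingCat.ofHom C) r, ?_⟩
      rw [← Scheme.Hom.comp_apply, ← Scheme.Hom.comp_apply]
      congr 1
      simp only [Category.assoc]
      rw [hφi, reassoc_of% hq, hg]
    · rintro e ⟨b, hb⟩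
      have heU : E.proj e ∈ U := hfU ⟨b, hb⟩
      obtain ⟨e', rfl⟩ : e ∈ Set.range ι := by
        rw [Scheme.Opens.range_ι]; exact heU
      have h1 : (AffineSpace (ULift.{u} (Fin n)) U.toScheme ↘ U.toScheme) (φ.hom e') = g b := by
        apply U.ι.isOpenEmbedding.injective
        rw [← Scheme.Hom.comp_apply, ← Scheme.Hom.comp_apply, ← Scheme.Hom.comp_apply, hg, hb,
          ← Scheme.Hom.comp_apply]
        congr 1
        rw [← hφi, Iso.hom_inv_id_assoc]
      obtain ⟨z, hz, -⟩ := Scheme.exists_preimage_of_isPullback hpb (φ.hom e') b h1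
      refine ⟨(AffineSpace.SpecIso _ R).hom z, ?_⟩
      have h2 : ι e' = (φ.hom ≫ φ.inv ≫ ι) e' := by rw [Iso.hom_inv_id_assoc]
      rw [h2, Scheme.Hom.comp_apply φ.hom, ← hz]
      simp only [← Scheme.Hom.comp_apply]
      congr 1
      simp [q]
  · intro x ψ hψ
    have hx : x.pt ∈ U := by
      apply hfU
      rw [KPoint.pt, ← hψ]
      exact ⟨_, rfl⟩
    -- `P v` is the `k`-point of affine space over `x` with coordinates `v`; by `eq_of_coords_eq`
    -- there is no other.
    let P (v : ULift.{u} (Fin n) → k) := Spec.map (CommRingCat.ofHom (eval₂Hom ψ v)) ≫ q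
    have hP (v) : P v ≫ (AffineSpace (ULift.{u} (Fin n)) U.toScheme ↘ U.toScheme) =
        Spec.map (CommRingCat.ofHom ψ) ≫ g := by
      simp only [P, Category.assoc, hq, ← Spec.map_comp_assoc, ← CommRingCat.ofHom_comp,
        eval₂Hom_comp_C]
    have hPc (v) : coords (P v) = fun i => v ⟨i⟩ := coords_comp_map g ψ v
    have hlift (e : Fibre E.proj x) : e.lift hx ≫ ι = e.hom := IsOpenImmersion.lift_fac _ _ _
    have hover (e : Fibre E.proj x) : (e.lift hx ≫ φ.hom) ≫
        (AffineSpace (ULift.{u} (Fin n)) U.toScheme ↘ U.toScheme) =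
          Spec.map (CommRingCat.ofHom ψ) ≫ g := by
      rw [← cancel_mono U.ι, Category.assoc, Category.assoc, Category.assoc, reassoc_of% hφ, hg,
        hψ, morphismRestrict_ι, ← e.hom_comp, ← hlift e, Category.assoc]
    have heq (e : Fibre E.proj x) (v) (h : coords (e.lift hx ≫ φ.hom) = fun i => v ⟨i⟩) :
        P v ≫ φ.inv ≫ ι = e.hom := by
      have : e.lift hx ≫ φ.hom = P v :=
        eq_of_coords_eq ((hover e).trans (hP v).symm) (h.trans (hPc v).symm)
      rw [← this, Category.assoc, Iso.hom_inv_id_assoc, hlift]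
    let c₀ : Fibre E.proj x →ₗ[k] (Fin n → k) := (hlin x hx).mk' _
    have hc₀ (e) : c₀ e = coords (e.lift hx ≫ φ.hom) := rfl
    have hbij : Function.Bijective c₀ := by
      constructor
      · intro e e' h
        ext1
        rw [← heq e (fun i => c₀ e i.down) rfl, ← heq e' (fun i => c₀ e i.down) h.symm]
      · intro w
        let v : ULift.{u} (Fin n) → k := fun i => w i.down
        let e : Fibre E.proj x := ⟨P v ≫ φ.inv ≫ ι, by
          simp only [Category.assoc]
          rw [hφi, reassoc_of% hP, hg, hψ]⟩
        have he : e.lift hx = P v ≫ φ.inv := by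
          rw [← cancel_mono ι, hlift, Category.assoc]
        exact ⟨e, by rw [hc₀, he, Category.assoc, Iso.inv_hom_id, Category.comp_id, hPc]⟩
    refine ⟨(LinearEquiv.ofBijective c₀ hbij).trans
      (LinearEquiv.funCongrLeft k k Equiv.ulift), fun e => ?_⟩
    rw [← Category.assoc]
    exact heq e _ rfl

end SubspaceFamily

/-! ### From the scheme `F` to ideals of families -/

namespace SubspaceFamily

open MvPolynomial SubBundle

variable {k : Type u} [Field k] {X : Scheme.{u}} {p : X ⟶ Spec (.of k)} {n : ℕ}

lemma asIdeal_SpecMap_closedPoint {R : CommRingCat.{u}} (ψ : R →+* k) :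
    PrimeSpectrum.asIdeal (Spec.map (CommRingCat.ofHom ψ) (IsLocalRing.closedPoint k)) =
      RingHom.ker ψ := by
  change Ideal.comap ψ (IsLocalRing.maximalIdeal k) = _
  rw [IsLocalRing.maximalIdeal_eq_bot]
  rfl

lemma comp_closedPoint {Y Z : Scheme.{u}} (f : Spec (.of k) ⟶ Y) (g : Y ⟶ Z) :
    (f ≫ g) (IsLocalRing.closedPoint k) = g (f (IsLocalRing.closedPoint k)) :=
  Scheme.Hom.comp_apply f g _

variable [IsAlgClosed k]

lemma pointOfClosedPoint_closedPoint {Y : Scheme.{u}} (q : Y ⟶ Spec (.of k))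
    [LocallyOfFiniteType q] (y : Y) (hy : IsClosed {y}) :
    pointOfClosedPoint q y hy (IsLocalRing.closedPoint k) = y :=
  pointOfClosedPoint_apply q y hy _

/-- Over an algebraically closed field a closed point carries exactly one `k`-point, and a point of
`F` mapping to a closed point of `E` is closed. This turns factoring through `F` into a topological
condition. -/
lemma mem_subFibre_iff (E : VectorBundle p n) {F : Scheme.{u}} (i : F ⟶ E.total)
    [IsClosedImmersion i] {x : KPoint p} (e : Fibre E.proj x) :
    e ∈ subFibre E i x ↔ e.hom (IsLocalRing.closedPoint k) ∈ Set.range i := by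
  have := E.isVariety.locallyOfFiniteType
  constructor
  · rintro ⟨f, hf⟩
    rw [← hf]
    exact ⟨f (IsLocalRing.closedPoint k), rfl⟩
  · rintro ⟨y, hy⟩
    have he : e.hom ≫ E.proj ≫ p = 𝟙 _ := by
      rw [← Category.assoc, e.hom_comp, x.hom_comp]
    have hcl : IsClosed {e.hom (IsLocalRing.closedPoint k)} :=
      (pointEquivClosedPoint (E.proj ≫ p) ⟨e.hom, he⟩).2
    have hycl : IsClosed {y} := by
      have : {y} = i ⁻¹' {e.hom (IsLocalRing.closedPoint k)} := by
        ext z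
        rw [Set.mem_preimage, Set.mem_singleton_iff, Set.mem_singleton_iff, ← hy,
          i.isClosedEmbedding.injective.eq_iff]
      rw [this]
      exact hcl.preimage i.continuous
    refine ⟨pointOfClosedPoint (i ≫ E.proj ≫ p) y hycl, ?_⟩
    refine ext_of_apply_closedPoint_eq (E.proj ≫ p) ?_ he ?_
    · rw [Category.assoc, pointOfClosedPoint_comp]
    · rw [comp_closedPoint, pointOfClosedPoint_closedPoint, hy]

lemma exists_isPreirreducible_preimage (hX : IsVariety p) [IrreducibleSpace X]
    (E : VectorBundle p n) {F : Scheme.{u}} (i : F ⟶ E.total) (hF : IsSubspaceFamily E i)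
    (x₀ : KPoint p) :
    ∃ U : Set X, IsOpen U ∧ x₀.pt ∈ U ∧ IsPreirreducible (Set.range i ∩ E.proj ⁻¹' U) := by
  have := hF.isClosedImmersion
  have := hX.isReduced
  have := hX.locallyOfFiniteType
  obtain ⟨d, hd⟩ := hF.exists_dim
  obtain ⟨R, f, J, hf, hx₀, hJ, hJf, hJrange, hchart⟩ := exists_chart E x₀.pt
  have hRne : Nonempty (Spec R) := ⟨hx₀.choose⟩
  have hXint : IsIntegral X := isIntegral_of_irreducibleSpace_of_isReduced X
  have hRint : IsIntegral (Spec R) := isIntegral_of_isOpenImmersion f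
  have hRdom : IsDomain R := (affine_isIntegral_iff R).1 hRint
  obtain ⟨ρ, hρ⟩ := Spec.map_surjective (f ≫ p)
  algebraize [ρ.hom]
  have hρft : LocallyOfFiniteType (Spec.map ρ) := hρ ▸ inferInstance
  have hft : Algebra.FiniteType k R :=
    (HasRingHomProperty.Spec_iff (P := @LocallyOfFiniteType)).1 hρft
  let pt (ψ : R →ₐ[k] k) : KPoint p := ⟨Spec.map (CommRingCat.ofHom ψ.toRingHom) ≫ f, by
    rw [Category.assoc, ← hρ, ← Spec.map_comp, ← Spec.map_id]
    congr 1
    ext c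
    exact ψ.commutes c⟩
  let T : Set (PrimeSpectrum (MvPolynomial (ULift.{u} (Fin n)) R)) := J ⁻¹' Set.range i
  have hT : IsClosed T := i.isClosedEmbedding.isClosed_range.preimage J.continuous
  have hTz : PrimeSpectrum.zeroLocus (PrimeSpectrum.vanishingIdeal T :
      Set (MvPolynomial (ULift.{u} (Fin n)) R)) = T := by
    rw [PrimeSpectrum.zeroLocus_vanishingIdeal_eq_closure, hT.closure_eq]
  -- The linear chart `c` carries the subspace `W` of each fibre to the zero set of the ideal of `T`
  -- there.
  have hfam : IsFamilyIdeal k (PrimeSpectrum.vanishingIdeal T) d := by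
    refine ⟨PrimeSpectrum.isRadical_vanishingIdeal T, fun ψ => ?_⟩
    obtain ⟨c, hc⟩ := hchart (pt ψ) ψ.toRingHom rfl
    obtain ⟨W, hW, hWd⟩ := hd (pt ψ)
    refine ⟨W.map c.toLinearMap, fun v => ?_, by
      rw [← hWd]; exact LinearEquiv.finrank_map_eq c W⟩
    have h1 : v ∈ W.map c.toLinearMap ↔ c.symm v ∈ subFibre E i (pt ψ) := by
      rw [← hW, SetLike.mem_coe]
      exact Submodule.mem_map_equiv (e := c) W
    rw [h1, mem_subFibre_iff, ← hc, LinearEquiv.apply_symm_apply, comp_closedPoint]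
    have hmem (y : PrimeSpectrum (MvPolynomial (ULift.{u} (Fin n)) R)) :
        y ∈ T ↔ PrimeSpectrum.vanishingIdeal T ≤ y.asIdeal := by
      conv_lhs => rw [← hTz]
      rw [PrimeSpectrum.mem_zeroLocus, SetLike.coe_subset_coe]
    refine (hmem (Spec.map (CommRingCat.ofHom
      (eval₂Hom ψ.toRingHom v)) (IsLocalRing.closedPoint k))).trans ?_
    rw [asIdeal_SpecMap_closedPoint (R := .of (MvPolynomial (ULift.{u} (Fin n)) R))]
    rfl
  have hx₀f : Set.range x₀.hom ⊆ Set.range f := by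
    rintro _ ⟨a, rfl⟩
    rwa [show a = IsLocalRing.closedPoint k from Subsingleton.elim (α := PrimeSpectrum k) _ _]
  -- The point `x₀` lies in the chart, so it is given by a `k`-algebra map from `R` to `k`.
  obtain ⟨ψ', hψ'⟩ := Spec.map_surjective (IsOpenImmersion.lift f x₀.hom hx₀f)
  have hψ'f : Spec.map ψ' ≫ f = x₀.hom := by rw [hψ', IsOpenImmersion.lift_fac]
  let ψ : R →ₐ[k] k := ⟨ψ'.hom, fun c => by
    have : ρ ≫ ψ' = 𝟙 _ := by
      apply Spec.map_injective
      rw [Spec.map_comp, hρ, reassoc_of% hψ'f, x₀.hom_comp, Spec.map_id]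
    exact congr($this c)⟩
  obtain ⟨g, hg, hirr⟩ := hfam.exists_isPreirreducible ψ
  refine ⟨f '' (PrimeSpectrum.basicOpen g : Set (PrimeSpectrum R)),
    f.isOpenEmbedding.isOpenMap _ (PrimeSpectrum.basicOpen g).isOpen, ?_, ?_⟩
  · refine ⟨Spec.map ψ' (IsLocalRing.closedPoint k), ?_, ?_⟩
    · change g ∉ PrimeSpectrum.asIdeal (Spec.map ψ' (IsLocalRing.closedPoint k))
      rw [show ψ' = CommRingCat.ofHom ψ.toRingHom from rfl, asIdeal_SpecMap_closedPoint]
      exact hg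
    · rw [← comp_closedPoint, hψ'f]
      rfl
  · have hset : Set.range i ∩
        E.proj ⁻¹' (f '' (PrimeSpectrum.basicOpen g : Set (PrimeSpectrum R))) =
        J '' (T ∩ (PrimeSpectrum.basicOpen (C (σ := ULift.{u} (Fin n)) g)).carrier) := by
      have hproj (r) : E.proj (J r) = f (Spec.map (CommRingCat.ofHom C) r) := by
        rw [← Scheme.Hom.comp_apply, hJf, Scheme.Hom.comp_apply]
      ext e
      constructor
      · rintro ⟨he, a, ha, hae⟩
        obtain ⟨r, rfl⟩ : e ∈ Set.range J := by
          rw [hJrange]; exact ⟨a, hae⟩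
        refine ⟨r, ⟨he, ?_⟩, rfl⟩
        rw [hproj] at hae
        obtain rfl := f.isOpenEmbedding.injective hae
        exact ha
      · rintro ⟨r, ⟨hrT, hr⟩, rfl⟩
        exact ⟨hrT, _, hr, (hproj r).symm⟩
    rw [hset, ← hTz]
    exact hirr.image _ J.continuous.continuousOn

end SubspaceFamily

/-! ### Irreducibility of `F` -/

theorem mainTheorem4 {k : Type u} [Field k] [IsAlgClosed k] {X : Scheme.{u}}
    (p : X ⟶ Spec (.of k)) (hX : SubBundle.IsVariety p) (hirr : IrreducibleSpace X)
    (n : ℕ) (E : SubBundle.VectorBundle p n)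
    {F : Scheme.{u}} (i : F ⟶ E.total) (hF : SubBundle.IsSubspaceFamily E i) :
    IrreducibleSpace F := by
  have := hF.isClosedImmersion
  have := hX.locallyOfFiniteType
  have := E.isVariety.locallyOfFiniteType
  have : JacobsonSpace X := LocallyOfFiniteType.jacobsonSpace p
  have : JacobsonSpace E.total := LocallyOfFiniteType.jacobsonSpace (E.proj ≫ p)
  -- As `X` is Jacobson, `U` contains a closed point, and the zero vector above it lies in `F`.
  have hne (U : Set X) (hU : IsOpen U) (hUne : U.Nonempty) :
      (Set.range i ∩ E.proj ⁻¹' U).Nonempty := by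
    obtain ⟨x, hxU, hx⟩ := nonempty_inter_closedPoints hUne hU.isLocallyClosed
    let x' : SubBundle.KPoint p := ⟨pointOfClosedPoint p x hx, pointOfClosedPoint_comp p x hx⟩
    obtain ⟨d, hd⟩ := hF.exists_dim
    obtain ⟨W, hW, -⟩ := hd x'
    have h0 : (0 : SubBundle.Fibre E.proj x') ∈ SubBundle.subFibre E i x' := by
      rw [← hW]; exact W.zero_mem
    refine ⟨_, (SubspaceFamily.mem_subFibre_iff E i _).1 h0, ?_⟩
    rw [Set.mem_preimage, ← SubspaceFamily.comp_closedPoint, SubBundle.Fibre.hom_comp]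
    exact (SubspaceFamily.pointOfClosedPoint_closedPoint p x hx).symm ▸ hxU
  have hZ : IsPreirreducible (Set.range i) := by
    refine SubspaceFamily.isPreirreducible_of_preimage E.proj.continuous (fun V hV hVne => ?_) hne
    -- A closed point of `E` is a `k`-point, so its image in `X` is one too and the local result
    -- applies there.
    obtain ⟨e, heV, he⟩ := nonempty_inter_closedPoints hVne
      (i.isClosedEmbedding.isClosed_range.isLocallyClosed.inter hV.isLocallyClosed)
    replace he : IsClosed {e} := he
    let x : SubBundle.KPoint p := ⟨pointOfClosedPoint (E.proj ≫ p) e he ≫ E.proj, by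
      rw [Category.assoc, pointOfClosedPoint_comp]⟩
    obtain ⟨U, hU, hxU, hirrU⟩ := SubspaceFamily.exists_isPreirreducible_preimage hX E i hF x
    refine ⟨e, heV, U, hU, ?_, hirrU⟩
    rwa [SubBundle.KPoint.pt, SubspaceFamily.comp_closedPoint,
      SubspaceFamily.pointOfClosedPoint_closedPoint] at hxU
  obtain ⟨_, ⟨y, -⟩, -⟩ := hne Set.univ isOpen_univ Set.univ_nonempty
  have : PreirreducibleSpace F := by
    rw [← Set.image_univ] at hZ
    refine ⟨fun u v hu hv hu' hv' => ?_⟩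
    obtain ⟨u, hu₀, rfl⟩ := i.isClosedEmbedding.isInducing.isOpen_iff.1 hu
    obtain ⟨v, hv₀, rfl⟩ := i.isClosedEmbedding.isInducing.isOpen_iff.1 hv
    obtain ⟨y₁, -, h₁⟩ := hu'
    obtain ⟨y₂, -, h₂⟩ := hv'
    obtain ⟨_, ⟨y, -, rfl⟩, h⟩ := hZ u v hu₀ hv₀
      ⟨_, ⟨y₁, trivial, rfl⟩, h₁⟩ ⟨_, ⟨y₂, trivial, rfl⟩, h₂⟩
    exact ⟨y, trivial, h⟩
  exact { toNonempty := ⟨y⟩ }
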